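/- **Theorem 2.1 (existence and uniqueness of a weak solution to the Boussinesq system).** Let $\Omega\subset\mathbb{R}^2$ be a bounded open set (for instance with Lipschitz boundary; no regularity of $\partial\Omega$ is needed when $H_0^1(\Omega)$ is defined as follows). Let $H^1(\Omega)$ be the Sobolev space with norm $\|u\|_{H^1(\Omega)}^2=\|u\|_{L^2(\Omega)}^2+\|\nabla u\|_{L^2(\Omega)}^2$, let $H_0^1(\Omega)$ be the closure of $C_c^\infty(\Omega)$ in $H^1(\Omega)$ (for Lipschitz $\Omega$: the functions with zero trace on $\partial\Omega$), and let $V(\Omega)=\{\boldsymbol\varphi\in H_0^1(\Omega)^2:\operatorname{div}\boldsymbol\varphi=0 \text{ a.e. in }\Omega\}$. Equip $V(\Omega)$ and $H_0^1(\Omega)$ with the norms $\|\nabla\cdot\|_{L^2(\Omega)}$, and their duals $V(\Omega)'$ and $H^{-1}(\Omega)$ with the dual norms. For $\mathrm{Re},\mathrm{Pr},\mathrm{Gr}>0$, $\mathbf g_1\in V(\Omega)'$, $g_2\in H^{-1}(\Omega)$, $T_d\in H^1(\Omega)$ and $\mathbf e=(0,1)$, a weak solution of the stationary Boussinesq system $$\mathbf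 v\cdot\nabla\mathbf v-\tfrac1{\mathrm{Re}}\Delta\mathbf v+\nabla p-\tfrac{\mathrm{Gr}}{\mathrm{Re}^2}T\mathbf e=\mathbf g_1,\quad \nabla\cdot\mathbf v=0,\quad \mathbf v\cdot\nabla T-\tfrac1{\mathrm{Re}\,\mathrm{Pr}}\Delta T=g_2\ \text{ in }\Omega,\qquad \mathbf v=0,\quad T=T_d\ \text{ on }\partial\Omega$$ is a pair $(\mathbf v,T)\in V(\Omega)\times H^1(\Omega)$ with $T-T_d\in H_0^1(\Omega)$ such that $$\int_\Omega(\mathbf v\cdot\nabla\mathbf v)\cdot\boldsymbol\varphi\,dx+\frac1{\mathrm{Re}}\int_\Omega\nabla\mathbf v:\nabla\boldsymbol\varphi\,dx-\frac{\mathrm{Gr}}{\mathrm{Re}^2}\int_\Omega T\,\mathbf e\cdot\boldsymbol\varphi\,dx=\langle\mathbf g_1,\boldsymbol\varphi\rangle\qquad\forall\,\boldsymbol\varphi\in V(\Omega),$$ $$\int_\Omega(\mathbf v\cdot\nabla T)\varphi\,dx+\frac1{\mathrm{Re}\,\mathrm{Pr}}\int_\Omega\nabla T\cdot\nabla\varphi\,dx=\langle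 g_2,\varphi\rangle\qquad\forall\,\varphi\in H_0^1(\Omega).$$ (If $T_d$ vanishes on $\partial\Omega\setminus\Gamma_\gamma$ for a boundary portion $\Gamma_\gamma$, the boundary condition says that $T=T_d$ on $\Gamma_\gamma$ and $T=0$ on $\partial\Omega\setminus\Gamma_\gamma$.) Then there are $\varepsilon_1,\varepsilon_2,\varepsilon_3,\delta>0$, depending only on $\Omega$, such that for all $$\mathrm{Re}\in(0,\varepsilon_1),\qquad \mathrm{Pr}\in\left(0,\frac{\varepsilon_2}{\mathrm{Re}}\right),\qquad \mathrm{Gr}\in(0,\varepsilon_3\mathrm{Re}),$$ and all $\mathbf g_1\in V(\Omega)'$, $g_2\in H^{-1}(\Omega)$, $T_d\in H^1(\Omega)$ with $\|\mathbf g_1\|_{V(\Omega)'}\le\delta$, $\|g_2\|_{H^{-1}(\Omega)}\le\delta$, $\|T_d\|_{H^1(\Omega)}\le\delta$, the system has exactly one weak solution $(\mathbf v,T)\in V(\Omega)\times H^1(\Omega)$. -/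

import Mathlib

open MeasureTheory Set
open scoped ContDiff

noncomputable section

/-- The Euclidean plane `ℝ²`. -/
abbrev Plane : Type := EuclideanSpace ℝ (Fin 2)

/-- The real Hilbert space `L²(Ω)`, for Lebesgue measure on `Ω`. -/
abbrev L2 (Ω : Set Plane) : Type := Lp ℝ 2 (volume.restrict Ω)

/-- The real Hilbert space `L²(Ω; ℝ²)`, with `‖w‖² = ‖w₀‖² + ‖w₁‖²`. -/
abbrev L2Vec (Ω : Set Plane) : Type := PiLp 2 (fun _ : Fin 2 => L2 Ω)

/-- The classical partial derivative `∂ᵢ φ`. -/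
def pderiv (i : Fin 2) (φ : Plane → ℝ) (x : Plane) : ℝ :=
  fderiv ℝ φ x (EuclideanSpace.single i 1)

/-- `φ ∈ C_c^∞(Ω)`. -/
structure IsTestFunction (Ω : Set Plane) (φ : Plane → ℝ) : Prop where
  contDiff : ContDiff ℝ ∞ φ
  hasCompactSupport : HasCompactSupport φ
  tsupport_subset : tsupport φ ⊆ Ω

/-- `w ∈ L²(Ω)` is the weak partial derivative `∂ᵢ u` of `u ∈ L²(Ω)` in `Ω`. -/
def IsWeakPartial (Ω : Set Plane) (i : Fin 2) (u w : L2 Ω) : Prop :=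
  ∀ φ : Plane → ℝ, IsTestFunction Ω φ →
    ∫ x in Ω, u x * pderiv i φ x = - ∫ x in Ω, w x * φ x

namespace IsTestFunction

variable {Ω : Set Plane} {φ ψ : Plane → ℝ}

theorem zero (Ω : Set Plane) : IsTestFunction Ω (fun _ => 0) where
  contDiff := contDiff_const
  hasCompactSupport := HasCompactSupport.zero
  tsupport_subset := by simp [tsupport]

theorem add (hφ : IsTestFunction Ω φ) (hψ : IsTestFunction Ω ψ) :
    IsTestFunction Ω (fun x => φ x + ψ x) where
  contDiff := hφ.contDiff.add hψ.contDiff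
  hasCompactSupport := hφ.hasCompactSupport.add hψ.hasCompactSupport
  tsupport_subset :=
    (tsupport_add φ ψ).trans (union_subset hφ.tsupport_subset hψ.tsupport_subset)

theorem const_mul (c : ℝ) (hφ : IsTestFunction Ω φ) :
    IsTestFunction Ω (fun x => c * φ x) where
  contDiff := contDiff_const.mul hφ.contDiff
  hasCompactSupport := hφ.hasCompactSupport.mul_left
  tsupport_subset := (tsupport_mul_subset_right (f := fun _ => c)).trans hφ.tsupport_subset

theorem differentiable (hφ : IsTestFunction Ω φ) : Differentiable ℝ φ :=
  hφ.contDiff.differentiable (by simp)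

theorem memLp (hφ : IsTestFunction Ω φ) : MemLp φ 2 (volume.restrict Ω) :=
  (hφ.contDiff.continuous.memLp_of_hasCompactSupport hφ.hasCompactSupport).restrict Ω

theorem memLp_pderiv (hφ : IsTestFunction Ω φ) (i : Fin 2) :
    MemLp (pderiv i φ) 2 (volume.restrict Ω) :=
  (((hφ.contDiff.continuous_fderiv (by simp)).clm_apply
    continuous_const).memLp_of_hasCompactSupport
      (hφ.hasCompactSupport.fderiv_apply (𝕜 := ℝ) (EuclideanSpace.single i 1))).restrict Ω

end IsTestFunction

theorem integrable_L2_mul {Ω : Set Plane} (u : L2 Ω) {f : Plane → ℝ}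
    (hf : MemLp f 2 (volume.restrict Ω)) : IntegrableOn (fun x => u x * f x) Ω :=
  (Lp.memLp u).integrable_mul hf

theorem integral_add_L2_mul {Ω : Set Plane} (u w : L2 Ω) {f : Plane → ℝ}
    (hf : MemLp f 2 (volume.restrict Ω)) :
    ∫ x in Ω, (u + w : L2 Ω) x * f x = (∫ x in Ω, u x * f x) + ∫ x in Ω, w x * f x := by
  rw [← integral_add (integrable_L2_mul u hf) (integrable_L2_mul w hf)]
  refine integral_congr_ae ?_
  filter_upwards [Lp.coeFn_add u w] with x hx
  simp only [hx, Pi.add_apply, add_mul]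

theorem integral_smul_L2_mul {Ω : Set Plane} (c : ℝ) (u : L2 Ω) (f : Plane → ℝ) :
    ∫ x in Ω, (c • u : L2 Ω) x * f x = c * ∫ x in Ω, u x * f x := by
  rw [← integral_const_mul]
  refine integral_congr_ae ?_
  filter_upwards [Lp.coeFn_smul c u] with x hx
  simp only [hx, Pi.smul_apply, smul_eq_mul, mul_assoc]

theorem integral_zero_L2_mul {Ω : Set Plane} (f : Plane → ℝ) :
    ∫ x in Ω, (0 : L2 Ω) x * f x = 0 := by
  simpa using integral_smul_L2_mul 0 (0 : L2 Ω) f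

/-- The Sobolev space `H¹(Ω)`. A function `u` is stored together with its weak gradient, as the
pair `(u, ∇u) ∈ L²(Ω) × L²(Ω; ℝ²)`, so that the norm inherited from the product is the usual one,
`‖u‖² = ‖u‖²_{L²} + ‖∇u‖²_{L²}`. -/
def H1 (Ω : Set Plane) : Submodule ℝ (WithLp 2 (L2 Ω × L2Vec Ω)) where
  carrier := {p | ∀ i, IsWeakPartial Ω i p.fst (p.snd i)}
  zero_mem' := by
    intro i φ _
    simp only [WithLp.zero_fst, WithLp.zero_snd, PiLp.zero_apply, integral_zero_L2_mul, neg_zero]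
  add_mem' := by
    intro p q hp hq i φ hφ
    simp only [WithLp.add_fst, WithLp.add_snd, PiLp.add_apply,
      integral_add_L2_mul _ _ hφ.memLp, integral_add_L2_mul _ _ (hφ.memLp_pderiv i)]
    rw [hp i φ hφ, hq i φ hφ, neg_add]
  smul_mem' := by
    intro c p hp i φ hφ
    simp only [WithLp.smul_fst, WithLp.smul_snd, PiLp.smul_apply, integral_smul_L2_mul]
    rw [hp i φ hφ, mul_neg]

/-- The function `u ∈ L²(Ω)` underlying an element of `H¹(Ω)`. -/
def toL2 {Ω : Set Plane} (u : H1 Ω) : L2 Ω := (u : WithLp 2 (L2 Ω × L2Vec Ω)).fst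

/-- The weak gradient `∇u ∈ L²(Ω; ℝ²)`; its `i`-th component is `∂ᵢ u`. -/
def grad {Ω : Set Plane} (u : H1 Ω) : L2Vec Ω := (u : WithLp 2 (L2 Ω × L2Vec Ω)).snd

/-- `C_c^∞(Ω)` as a subspace of `H¹(Ω)`. -/
def testSubspace (Ω : Set Plane) : Submodule ℝ (H1 Ω) where
  carrier := {u | ∃ φ : Plane → ℝ, IsTestFunction Ω φ ∧
    toL2 u =ᵐ[volume.restrict Ω] φ ∧ ∀ i, grad u i =ᵐ[volume.restrict Ω] pderiv i φ}
  zero_mem' := by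
    refine ⟨fun _ => 0, IsTestFunction.zero Ω, Lp.coeFn_zero _ _ _, fun i => ?_⟩
    filter_upwards [Lp.coeFn_zero ℝ 2 (volume.restrict Ω)] with x hx
    have h : pderiv i (fun _ => (0 : ℝ)) x = 0 := by simp [pderiv]
    rw [h]
    exact hx
  add_mem' := by
    rintro u w ⟨φ, hφ, hu, hu'⟩ ⟨ψ, hψ, hw, hw'⟩
    refine ⟨fun x => φ x + ψ x, hφ.add hψ, ?_, fun i => ?_⟩
    · filter_upwards [hu, hw, Lp.coeFn_add (toL2 u) (toL2 w)] with x h1 h2 h3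
      rw [← h1, ← h2]
      exact h3
    · filter_upwards [hu' i, hw' i, Lp.coeFn_add (grad u i) (grad w i)] with x h1 h2 h3
      have h4 : pderiv i (fun x => φ x + ψ x) x = pderiv i φ x + pderiv i ψ x := by
        simp only [pderiv]
        rw [fderiv_fun_add hφ.differentiable.differentiableAt hψ.differentiable.differentiableAt]
        rfl
      rw [h4, ← h1, ← h2]
      exact h3
  smul_mem' := by
    rintro c u ⟨φ, hφ, hu, hu'⟩
    refine ⟨fun x => c * φ x, hφ.const_mul c, ?_, fun i => ?_⟩
    · filter_upwards [hu, Lp.coeFn_smul c (toL2 u)] with x h1 h2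
      rw [← h1]
      exact h2
    · filter_upwards [hu' i, Lp.coeFn_smul c (grad u i)] with x h1 h2
      have h4 : pderiv i (fun x => c * φ x) x = c * pderiv i φ x := by
        simp only [pderiv]
        rw [fderiv_const_mul hφ.differentiable.differentiableAt]
        rfl
      rw [h4, ← h1]
      exact h2

/-- `H₀¹(Ω)`, the closure of `C_c^∞(Ω)` in `H¹(Ω)`. For bounded open sets with Lipschitz boundary
these are the functions of `H¹(Ω)` that vanish on `∂Ω` in the trace sense. -/
def H01 (Ω : Set Plane) : Submodule ℝ (H1 Ω) := (testSubspace Ω).topologicalClosure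

/-- `H¹(Ω; ℝ²)`. -/
abbrev H1Vec (Ω : Set Plane) : Type := PiLp 2 (fun _ : Fin 2 => H1 Ω)

/-- `V(Ω)`: the fields of `H¹(Ω; ℝ²)` that vanish on the boundary (both components are in
`H₀¹(Ω)`) and satisfy `∂₀ v₀ + ∂₁ v₁ = 0` a.e. in `Ω`. -/
def V (Ω : Set Plane) : Submodule ℝ (H1Vec Ω) where
  carrier := {v | (∀ i, v i ∈ H01 Ω) ∧ ∑ i, grad (v i) i = 0}
  zero_mem' := ⟨fun _ => (H01 Ω).zero_mem, by simp [grad]⟩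
  add_mem' := by
    rintro v w ⟨hv, hv'⟩ ⟨hw, hw'⟩
    refine ⟨fun i => (H01 Ω).add_mem (hv i) (hw i), ?_⟩
    have h : ∀ i, grad ((v + w) i) i = grad (v i) i + grad (w i) i := fun _ => rfl
    simp only [h, Finset.sum_add_distrib, hv', hw', add_zero]
  smul_mem' := by
    rintro c v ⟨hv, hv'⟩
    refine ⟨fun i => (H01 Ω).smul_mem c (hv i), ?_⟩
    have h : ∀ i, grad ((c • v) i) i = c • grad (v i) i := fun _ => rfl
    simp only [h, ← Finset.smul_sum, hv', smul_zero]

section Forms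

variable {Ω : Set Plane}

/-- `(∇u, ∇w)₂` for scalar functions. -/
def gradInner (u w : H1 Ω) : ℝ := inner ℝ (grad u) (grad w)

/-- `(∇v, ∇w)₂ = ∑ⱼ (∇vⱼ, ∇wⱼ)₂` for vector fields. -/
def gradInnerVec (v w : H1Vec Ω) : ℝ := ∑ j, gradInner (v j) (w j)

/-- `(∫_Ω |∇u|²)^{1/2}`, the norm of `H₀¹(Ω)`. -/
def gradNorm (u : H1 Ω) : ℝ := √(gradInner u u)

/-- `(∫_Ω |∇v|²)^{1/2}`, the norm of `V(Ω)`. -/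
def gradNormVec (v : H1Vec Ω) : ℝ := √(gradInnerVec v v)

/-- `b₁(v, w, φ) = ∫_Ω ((v · ∇) w) · φ`. -/
def b1 (v w φ : H1Vec Ω) : ℝ :=
  ∫ x in Ω, ∑ j, (∑ i, toL2 (v i) x * grad (w j) i x) * toL2 (φ j) x

/-- `b₂(v, T, φ) = ∫_Ω (v · ∇T) φ`. -/
def b2 (v : H1Vec Ω) (T φ : H1 Ω) : ℝ :=
  ∫ x in Ω, (∑ i, toL2 (v i) x * grad T i x) * toL2 φ x

/-- The unit vector `e = (0, 1)` of the buoyancy. -/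
def buoyancyDir : Fin 2 → ℝ := ![0, 1]

/-- `(T e, φ)₂ = ∫_Ω T e · φ`. -/
def buoyancy (T : H1 Ω) (φ : H1Vec Ω) : ℝ :=
  ∫ x in Ω, ∑ j, (toL2 T x * buoyancyDir j) * toL2 (φ j) x

/-- `(v, T) ∈ V(Ω) × H¹(Ω)` is a weak solution of the stationary Boussinesq system with Reynolds,
Prandtl and Grashof numbers `Re`, `Pr`, `Gr`, right-hand sides `g₁`, `g₂` and temperature
datum `Td`. -/
structure IsWeakSolution (Re Pr Gr : ℝ) (g₁ : V Ω →ₗ[ℝ] ℝ) (g₂ : H01 Ω →ₗ[ℝ] ℝ) (Td : H1 Ω)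
    (v : V Ω) (T : H1 Ω) : Prop where
  boundary : T - Td ∈ H01 Ω
  momentum : ∀ φ : V Ω,
    b1 (v : H1Vec Ω) v φ + 1 / Re * gradInnerVec (v : H1Vec Ω) φ
      - Gr / Re ^ 2 * buoyancy T φ = g₁ φ
  heat : ∀ φ : H01 Ω,
    b2 (v : H1Vec Ω) T φ + 1 / (Re * Pr) * gradInner T φ = g₂ φ

/-- The linear functional `g` belongs to `V(Ω)'` and `‖g‖_{V(Ω)'} ≤ M`. -/
def VDualNormLE (g : V Ω →ₗ[ℝ] ℝ) (M : ℝ) : Prop :=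
  ∀ φ : V Ω, |g φ| ≤ M * gradNormVec (φ : H1Vec Ω)

/-- The linear functional `g` belongs to `H⁻¹(Ω)` and `‖g‖_{H⁻¹(Ω)} ≤ M`. -/
def HNegOneNormLE (g : H01 Ω →ₗ[ℝ] ℝ) (M : ℝ) : Prop :=
  ∀ φ : H01 Ω, |g φ| ≤ M * gradNorm (φ : H1 Ω)

end Forms

end

/-!
# Unique weak solvability of the stationary Boussinesq system for small data

Multiplied by `Re` and `Re Pr`, the system for `v` and `S = T - Td` reads

`(∇v, ∇φ) = Re g₁(φ) - Re b₁(v, v, φ) + (Gr / Re) (T e, φ)`,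
`(∇S, ∇φ) = Re Pr g₂(φ) - Re Pr b₂(v, T, φ) - (∇Td, ∇φ)`,  with `T = Td + S`,

so the hypotheses on the parameters say that the coefficients `Re`, `Gr / Re` and `Re Pr` are small,
while the last term is small with `Td`. The left-hand sides are coercive by the Poincaré
inequality, so by the Lax-Milgram theorem the system is a fixed point equation on
`V(Ω) × H₀¹(Ω)`. The convection forms are bounded on `H₀¹ × L² × H₀¹` by Hölder's inequality and
the embedding of `H₀¹(Ω)` into `L⁴(Ω)`. This embedding and the Poincaré inequality come from the
Gagliardo-Nirenberg-Sobolev inequality for test functions (`exists_eLpNorm_le_norm_grad`). No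
embedding of `H¹(Ω)` is needed, because in `b₂(v, T, φ)` only the gradient of `T` occurs; hence the
boundary of `Ω` may be arbitrary.

For small parameters the fixed point map is a contraction of the unit ball, which gives a solution
that is unique in this ball. Uniqueness among all solutions rests on the cancellations
`b₁(v, v, v) = 0` and `b₂(v, S, S) = 0` (`b1_self`, `b2_self`): tested with itself, any solution
satisfies an a priori bound that puts it into the ball. The functional-analytic part is
`exists_forall_existsUnique_boussinesq`.
-/

noncomputable section

open Filter Topology
open scoped ENNReal NNReal

-- The norms and module structures of `V Ω` and `H01 Ω` are inherited through several layers of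
-- submodules and `L²` products, which makes their unification expensive.
set_option maxSynthPendingDepth 3
set_option maxHeartbeats 4000000

variable {Ω : Set Plane}

/-! ### Continuous linear maps out of `H¹(Ω)` -/

/-- `toL2` as a continuous linear map. -/
def toL2CLM (Ω : Set Plane) : H1 Ω →L[ℝ] L2 Ω :=
  (WithLp.fstL 2 ℝ (L2 Ω) (L2Vec Ω)).comp (H1 Ω).subtypeL

/-- `grad` as a continuous linear map. -/
def gradCLM (Ω : Set Plane) : H1 Ω →L[ℝ] L2Vec Ω :=
  (WithLp.sndL 2 ℝ (L2 Ω) (L2Vec Ω)).comp (H1 Ω).subtypeL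

/-- The weak partial derivative `∂ᵢ` as a continuous linear map. -/
def partialCLM (Ω : Set Plane) (i : Fin 2) : H1 Ω →L[ℝ] L2 Ω :=
  (PiLp.proj 2 (fun _ : Fin 2 => L2 Ω) i).comp (gradCLM Ω)

@[simp] theorem partialCLM_apply (i : Fin 2) (u : H1 Ω) : partialCLM Ω i u = grad u i := rfl

theorem H1.norm_sq_eq (u : H1 Ω) : ‖u‖ ^ 2 = ‖toL2 u‖ ^ 2 + ‖grad u‖ ^ 2 :=
  WithLp.prod_norm_sq_eq_of_L2 (u : WithLp 2 (L2 Ω × L2Vec Ω))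

theorem norm_grad_le (u : H1 Ω) : ‖grad u‖ ≤ ‖u‖ := by
  refine le_of_sq_le_sq ?_ (norm_nonneg _)
  rw [H1.norm_sq_eq]
  nlinarith [sq_nonneg ‖toL2 u‖]

/-! ### The Sobolev inequality on `H₀¹(Ω)` -/

theorem norm_fderiv_le_sum_pderiv (φ : Plane → ℝ) (x : Plane) :
    ‖fderiv ℝ φ x‖ ≤ ∑ i, ‖pderiv i φ x‖ := by
  refine ContinuousLinearMap.opNorm_le_bound _ (by positivity) fun y => ?_
  have hy : y = ∑ i, y i • EuclideanSpace.single i (1 : ℝ) := by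
    ext j
    fin_cases j <;> simp
  have h : fderiv ℝ φ x y = ∑ i, y i * pderiv i φ x := by
    conv_lhs => rw [hy]
    simp only [map_sum, map_smul, smul_eq_mul, pderiv]
  rw [h, Finset.sum_mul]
  refine (norm_sum_le _ _).trans (Finset.sum_le_sum fun i _ => ?_)
  rw [norm_mul, mul_comm]
  gcongr
  exact PiLp.norm_apply_le y i

theorem IsTestFunction.support_fderiv_subset_domain {φ : Plane → ℝ} (hφ : IsTestFunction Ω φ) :
    Function.support (fderiv ℝ φ) ⊆ Ω :=
  (support_fderiv_subset ℝ).trans hφ.tsupport_subset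

theorem eLpNorm_eq_eLpNorm_restrict {E F : Type*} [MeasurableSpace E] [NormedAddCommGroup F]
    {μ : Measure E} {s : Set E} {f : E → F} (h : Function.support f ⊆ s) (p : ℝ≥0∞) :
    eLpNorm f p μ = eLpNorm f p (μ.restrict s) :=
  (eLpNorm_restrict_eq_of_support_subset h).symm

theorem IsTestFunction.eLpNorm_fderiv_le {φ : Plane → ℝ} (hφ : IsTestFunction Ω φ) :
    eLpNorm (fderiv ℝ φ) 2 (volume.restrict Ω) ≤
      ∑ i, eLpNorm (pderiv i φ) 2 (volume.restrict Ω) := by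
  calc eLpNorm (fderiv ℝ φ) 2 (volume.restrict Ω)
      ≤ eLpNorm (∑ i, fun x => ‖pderiv i φ x‖) 2 (volume.restrict Ω) := by
        refine eLpNorm_mono_real fun x => ?_
        simpa using norm_fderiv_le_sum_pderiv φ x
    _ ≤ ∑ i, eLpNorm (fun x => ‖pderiv i φ x‖) 2 (volume.restrict Ω) :=
        eLpNorm_sum_le (fun i _ => (hφ.memLp_pderiv i).1.norm) (by norm_num)
    _ = _ := by simp only [eLpNorm_norm]

theorem exists_eLpNorm_le_eLpNorm_fderiv (hΩb : Bornology.IsBounded Ω)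
    {p q : ℝ≥0} (hp : (p : ℝ) = 4 / 3) (hq0 : 0 < q) (hq : q ≤ 4) :
    ∃ K : ℝ≥0, ∀ φ : Plane → ℝ, IsTestFunction Ω φ →
      eLpNorm φ q volume ≤ K * eLpNorm (fderiv ℝ φ) p volume := by
  have hp1 : 1 ≤ p := by rw [← NNReal.coe_le_coe, hp]; norm_num
  have hp2 : p < 2 := by rw [← NNReal.coe_lt_coe, hp]; norm_num
  have h1 : (4 : ℝ)⁻¹ ≤ (q : ℝ)⁻¹ := by
    gcongr
    exact_mod_cast hq
  have h2 : ((p⁻¹ : ℝ≥0) : ℝ) - (Module.finrank ℝ Plane : ℝ)⁻¹ ≤ (q : ℝ)⁻¹ := by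
    refine le_trans (le_of_eq ?_) h1
    norm_num [hp]
  exact ⟨_, fun φ hφ => eLpNorm_le_eLpNorm_fderiv_of_le volume (hφ.contDiff.of_le (by simp))
    ((subset_tsupport φ).trans hφ.tsupport_subset) hp1 (by simpa using hp2) h2 hΩb⟩

/-- Hölder's inequality on a bounded domain. -/
theorem exists_eLpNorm_le_eLpNorm_two (hΩb : Bornology.IsBounded Ω) {p : ℝ≥0}
    (hp0 : 0 < p) (hp : p ≤ 2) :
    ∃ m : ℝ≥0, ∀ f : Plane → Plane →L[ℝ] ℝ, Continuous f →
      eLpNorm f p (volume.restrict Ω) ≤ eLpNorm f 2 (volume.restrict Ω) * m := by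
  have hvol : volume Ω < ⊤ := hΩb.measure_lt_top
  have he : 0 ≤ 1 / (p : ℝ≥0∞).toReal - 1 / (2 : ℝ≥0∞).toReal := by
    rw [ENNReal.coe_toReal, ENNReal.toReal_ofNat, sub_nonneg]
    exact one_div_le_one_div_of_le (mod_cast hp0) (mod_cast hp)
  refine ⟨(volume Ω ^ (1 / (p : ℝ≥0∞).toReal - 1 / (2 : ℝ≥0∞).toReal)).toNNReal,
    fun f hf => ?_⟩
  rw [ENNReal.coe_toNNReal (ENNReal.rpow_ne_top_of_nonneg he hvol.ne)]
  have hp' : (p : ℝ≥0∞) ≤ 2 := mod_cast hp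
  simpa only [Measure.restrict_apply_univ] using eLpNorm_le_eLpNorm_mul_rpow_measure_univ
    (μ := volume.restrict Ω) hp' hf.aestronglyMeasurable

/-- The Sobolev inequality for test functions, from the Gagliardo-Nirenberg-Sobolev inequality
with exponent `4/3` for the derivative. -/
theorem exists_eLpNorm_le_of_isTestFunction (hΩb : Bornology.IsBounded Ω)
    {q : ℝ≥0} (hq0 : 0 < q) (hq : q ≤ 4) :
    ∃ C : ℝ≥0, ∀ φ : Plane → ℝ, IsTestFunction Ω φ →
      eLpNorm φ q (volume.restrict Ω) ≤
        C * ∑ i, eLpNorm (pderiv i φ) 2 (volume.restrict Ω) := by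
  obtain ⟨p, hp⟩ : ∃ p : ℝ≥0, (p : ℝ) = 4 / 3 := ⟨4 / 3, by norm_num⟩
  obtain ⟨K, hK⟩ := exists_eLpNorm_le_eLpNorm_fderiv hΩb hp hq0 hq
  obtain ⟨m, hm⟩ := exists_eLpNorm_le_eLpNorm_two hΩb (p := p)
    (by rw [← NNReal.coe_pos, hp]; norm_num) (by rw [← NNReal.coe_le_coe, hp]; norm_num)
  refine ⟨K * m, fun φ hφ => ?_⟩
  calc eLpNorm φ q (volume.restrict Ω) ≤ eLpNorm φ q volume :=
        eLpNorm_mono_measure _ Measure.restrict_le_self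
    _ ≤ K * eLpNorm (fderiv ℝ φ) p volume := hK φ hφ
    _ = K * eLpNorm (fderiv ℝ φ) p (volume.restrict Ω) := by
        rw [eLpNorm_eq_eLpNorm_restrict hφ.support_fderiv_subset_domain]
    _ ≤ K * ((∑ i, eLpNorm (pderiv i φ) 2 (volume.restrict Ω)) * m) := by
        gcongr
        exact (hm _ (hφ.contDiff.continuous_fderiv (by simp))).trans
          (mul_le_mul_left hφ.eLpNorm_fderiv_le _)
    _ = _ := by
        rw [ENNReal.coe_mul]
        ring

/-- The Sobolev inequality on `H₀¹(Ω)`: for `q = 2` this is the Poincaré inequality, for `q = 4` the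
Ladyzhenskaya embedding. It passes from test functions to the closure by Fatou's lemma. -/
theorem exists_eLpNorm_le_norm_grad (hΩb : Bornology.IsBounded Ω)
    {q : ℝ≥0} (hq0 : 0 < q) (hq : q ≤ 4) :
    ∃ C : ℝ, 0 ≤ C ∧ ∀ u ∈ H01 Ω,
      eLpNorm (toL2 u) q (volume.restrict Ω) ≤ ENNReal.ofReal (C * ‖grad u‖) := by
  obtain ⟨K, hK⟩ := exists_eLpNorm_le_of_isTestFunction hΩb hq0 hq
  refine ⟨2 * K, by positivity, fun u hu => ?_⟩
  have htest : ∀ w ∈ testSubspace Ω,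
      eLpNorm (toL2 w) q (volume.restrict Ω) ≤ ENNReal.ofReal (2 * K * ‖grad w‖) := by
    rintro w ⟨φ, hφ, hw, hw'⟩
    have hi : ∀ i, eLpNorm (pderiv i φ) 2 (volume.restrict Ω) ≤ ENNReal.ofReal ‖grad w‖ := by
      intro i
      rw [← eLpNorm_congr_ae (hw' i), ← Lp.enorm_def, ← ofReal_norm]
      exact ENNReal.ofReal_le_ofReal (PiLp.norm_apply_le (grad w) i)
    rw [eLpNorm_congr_ae hw]
    refine (hK φ hφ).trans ?_
    calc (K : ℝ≥0∞) * ∑ i, eLpNorm (pderiv i φ) 2 (volume.restrict Ω)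
        ≤ K * ∑ _i : Fin 2, ENNReal.ofReal ‖grad w‖ := by
          gcongr with i; exact hi i
      _ = ENNReal.ofReal (2 * K * ‖grad w‖) := by
          rw [ENNReal.ofReal_mul (by positivity), ENNReal.ofReal_mul (by positivity),
            ENNReal.ofReal_coe_nnreal]
          simp
          ring
  obtain ⟨s, hs, hlim⟩ := mem_closure_iff_seq_limit.1 hu
  refine le_of_forall_gt_imp_ge_of_dense fun b hb => ?_
  have hcont : Tendsto (fun n => ENNReal.ofReal (2 * K * ‖grad (s n)‖)) atTop
      (𝓝 (ENNReal.ofReal (2 * K * ‖grad u‖))) := by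
    refine (ENNReal.continuous_ofReal.tendsto _).comp (Tendsto.const_mul _ ?_)
    exact (((gradCLM Ω).continuous.norm).tendsto u).comp hlim
  refine eLpNorm_le_of_tendstoInMeasure (f := fun n => toL2 (s n)) (u := atTop) ?_
    (tendstoInMeasure_of_tendsto_Lp (((toL2CLM Ω).continuous.tendsto u).comp hlim))
    fun n => Lp.aestronglyMeasurable _
  filter_upwards [hcont.eventually_lt_const hb] with n hn
  exact (htest _ (hs n)).trans hn.le

/-- The Poincaré inequality. -/
theorem exists_norm_toL2_le (hΩb : Bornology.IsBounded Ω) :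
    ∃ C : ℝ, 0 ≤ C ∧ ∀ u ∈ H01 Ω, ‖toL2 u‖ ≤ C * ‖grad u‖ := by
  obtain ⟨C, hC, h⟩ := exists_eLpNorm_le_norm_grad hΩb (q := 2) (by norm_num) (by norm_num)
  refine ⟨C, hC, fun u hu => ?_⟩
  rw [Lp.norm_def]
  exact ENNReal.toReal_le_of_le_ofReal (by positivity) (h u hu)

/-! ### Completeness of the spaces -/

theorem integral_L2_mul_eq_inner (u : L2 Ω) {f : Plane → ℝ} (hf : MemLp f 2 (volume.restrict Ω)) :
    ∫ x in Ω, u x * f x = inner ℝ (hf.toLp f) u := by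
  rw [L2.inner_def]
  refine integral_congr_ae ?_
  filter_upwards [hf.coeFn_toLp] with x hx
  simp [hx]

theorem isClosed_H1 (Ω : Set Plane) :
    IsClosed (H1 Ω : Set (WithLp 2 (L2 Ω × L2Vec Ω))) := by
  have h : (H1 Ω : Set (WithLp 2 (L2 Ω × L2Vec Ω))) =
      ⋂ (i : Fin 2) (φ : Plane → ℝ) (_ : IsTestFunction Ω φ),
        {p | ∫ x in Ω, p.fst x * pderiv i φ x = - ∫ x in Ω, p.snd i x * φ x} := by
    ext p
    simp [H1, IsWeakPartial]
  rw [h]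
  refine isClosed_iInter fun i => isClosed_iInter fun φ => isClosed_iInter fun hφ => ?_
  simp only [integral_L2_mul_eq_inner _ (hφ.memLp_pderiv i), integral_L2_mul_eq_inner _ hφ.memLp]
  refine isClosed_eq ?_ ?_
  · exact continuous_const.inner (WithLp.fstL 2 ℝ (L2 Ω) (L2Vec Ω)).continuous
  · exact (continuous_const.inner ((PiLp.proj 2 (𝕜 := ℝ) (fun _ : Fin 2 => L2 Ω) i).comp
      (WithLp.sndL 2 ℝ (L2 Ω) (L2Vec Ω))).continuous).neg

instance H1.instCompleteSpace : CompleteSpace (H1 Ω) :=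
  (isClosed_H1 Ω).completeSpace_coe

theorem isClosed_H01 (Ω : Set Plane) : IsClosed (H01 Ω : Set (H1 Ω)) :=
  Submodule.isClosed_topologicalClosure _

instance H01.instCompleteSpace : CompleteSpace (H01 Ω) :=
  (isClosed_H01 Ω).completeSpace_coe

theorem isClosed_V (Ω : Set Plane) : IsClosed (V Ω : Set (H1Vec Ω)) := by
  have hproj : ∀ i, Continuous fun v : H1Vec Ω => v i := fun i =>
    (PiLp.proj 2 (𝕜 := ℝ) (fun _ : Fin 2 => H1 Ω) i).continuous
  have h : (V Ω : Set (H1Vec Ω)) =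
      (⋂ i, {v : H1Vec Ω | v i ∈ (H01 Ω : Set (H1 Ω))}) ∩ {v | ∑ i, partialCLM Ω i (v i) = 0} := by
    ext v
    simp [V]
  rw [h]
  refine (isClosed_iInter fun i => (isClosed_H01 Ω).preimage (hproj i)).inter
    (isClosed_eq ?_ continuous_const)
  exact continuous_finsetSum _ fun i _ => (partialCLM Ω i).continuous.comp (hproj i)

instance V.instCompleteSpace : CompleteSpace (V Ω) :=
  (isClosed_V Ω).completeSpace_coe

/-- The `i`-th component `v ↦ vᵢ`, as a map from `V(Ω)` to `H₀¹(Ω)`. -/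
def V.componentCLM (Ω : Set Plane) (i : Fin 2) : V Ω →L[ℝ] H01 Ω :=
  ((PiLp.proj 2 (𝕜 := ℝ) (fun _ : Fin 2 => H1 Ω) i).comp (V Ω).subtypeL).codRestrict (H01 Ω)
    fun v => v.2.1 i

@[simp] theorem V.coe_componentCLM_apply (i : Fin 2) (v : V Ω) :
    (V.componentCLM Ω i v : H1 Ω) = (v : H1Vec Ω) i := rfl

/-! ### Gradient norms and coercivity -/

theorem gradInner_self (u : H1 Ω) : gradInner u u = ‖grad u‖ ^ 2 :=
  real_inner_self_eq_norm_sq _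

theorem gradNorm_eq (u : H1 Ω) : gradNorm u = ‖grad u‖ := by
  rw [gradNorm, gradInner_self, Real.sqrt_sq (norm_nonneg _)]

theorem gradNorm_le (u : H1 Ω) : gradNorm u ≤ ‖u‖ :=
  (gradNorm_eq u).trans_le (norm_grad_le u)

theorem gradNormVec_le (v : H1Vec Ω) : gradNormVec v ≤ ‖v‖ := by
  refine Real.sqrt_le_iff.2 ⟨norm_nonneg _, ?_⟩
  rw [PiLp.norm_sq_eq_of_L2, gradInnerVec]
  gcongr with i
  rw [gradInner_self]
  gcongr
  exact norm_grad_le _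

/-- By the Poincaré inequality, `‖∇u‖²` controls the full `H¹` norm on `H₀¹(Ω)`. -/
theorem exists_coercive_gradInner (hΩb : Bornology.IsBounded Ω) :
    ∃ α : ℝ, 0 < α ∧ α ≤ 1 ∧ ∀ u ∈ H01 Ω, α * ‖u‖ ^ 2 ≤ gradInner u u := by
  obtain ⟨C, hC, h⟩ := exists_norm_toL2_le hΩb
  refine ⟨(1 + C ^ 2)⁻¹, by positivity, inv_le_one_of_one_le₀ (by nlinarith), fun u hu => ?_⟩
  rw [gradInner_self, inv_mul_le_iff₀ (by positivity), H1.norm_sq_eq]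
  have := pow_le_pow_left₀ (norm_nonneg _) (h u hu) 2
  nlinarith

theorem coercive_gradInnerVec {α : ℝ} (h : ∀ u ∈ H01 Ω, α * ‖u‖ ^ 2 ≤ gradInner u u) (v : V Ω) :
    α * ‖v‖ ^ 2 ≤ gradInnerVec (v : H1Vec Ω) v := by
  change α * ‖(v : H1Vec Ω)‖ ^ 2 ≤ _
  rw [PiLp.norm_sq_eq_of_L2, gradInnerVec, Finset.mul_sum]
  exact Finset.sum_le_sum fun i _ => h _ (v.2.1 i)

/-! ### The trilinear convection forms -/

instance fact_one_le_four : Fact ((1 : ℝ≥0∞) ≤ 4) := ⟨by norm_num⟩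

instance holderTriple_four_four_two : ENNReal.HolderTriple 4 4 2 where
  inv_add_inv_eq_inv := by
    have h : (4 : ℝ≥0∞) = 2 * 2 := by norm_num
    rw [h, ENNReal.mul_inv (by simp) (by simp), ← mul_add, ENNReal.inv_two_add_inv_two, mul_one]

/-- The embedding `H₀¹(Ω) → L⁴(Ω)`. -/
theorem exists_embedding_L4 (hΩb : Bornology.IsBounded Ω) :
    ∃ E : H01 Ω →L[ℝ] Lp ℝ 4 (volume.restrict Ω),
      ∀ u, E u =ᵐ[volume.restrict Ω] toL2 (u : H1 Ω) := by
  obtain ⟨C, hC, h⟩ := exists_eLpNorm_le_norm_grad hΩb (q := 4) (by norm_num) le_rfl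
  have hmem : ∀ u : H01 Ω, MemLp (toL2 (u : H1 Ω)) 4 (volume.restrict Ω) := fun u =>
    ⟨Lp.aestronglyMeasurable _, (h u u.2).trans_lt ENNReal.ofReal_lt_top⟩
  -- Linearity holds because both embeddings represent the same function almost everywhere.
  let L : H01 Ω →ₗ[ℝ] Lp ℝ 4 (volume.restrict Ω) :=
    { toFun := fun u => (hmem u).toLp
      map_add' := fun u w => by
        rw [← MemLp.toLp_add]
        exact MemLp.toLp_congr _ _ (Lp.coeFn_add (toL2 (u : H1 Ω)) (toL2 (w : H1 Ω)))
      map_smul' := fun c u => by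
        rw [RingHom.id_apply, ← MemLp.toLp_const_smul]
        exact MemLp.toLp_congr _ _ (Lp.coeFn_smul c (toL2 (u : H1 Ω))) }
  refine ⟨L.mkContinuous C fun u => ?_, fun u => (hmem u).coeFn_toLp⟩
  change ‖(hmem u).toLp‖ ≤ _
  rw [Lp.norm_toLp]
  refine (ENNReal.toReal_le_of_le_ofReal (by positivity) (h u u.2)).trans ?_
  gcongr
  exact norm_grad_le _

section Multilinear

variable {A B C H X Y Z : Type*}
  [NormedAddCommGroup A] [NormedSpace ℝ A] [NormedAddCommGroup B] [NormedSpace ℝ B]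
  [NormedAddCommGroup C] [NormedSpace ℝ C] [NormedAddCommGroup H] [InnerProductSpace ℝ H]
  [NormedAddCommGroup X] [NormedSpace ℝ X] [NormedAddCommGroup Y] [NormedSpace ℝ Y]
  [NormedAddCommGroup Z] [NormedSpace ℝ Z]

theorem ContinuousLinearMap.exists_trilinear_inner (m : A →L[ℝ] A →L[ℝ] H) (E : X →L[ℝ] A) :
    ∃ t : X →L[ℝ] H →L[ℝ] X →L[ℝ] ℝ, ∀ u g w, t u g w = inner ℝ (m (E u) (E w)) g := by
  let s : X →L[ℝ] X →L[ℝ] H →L[ℝ] ℝ :=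
    (compL ℝ X H (H →L[ℝ] ℝ) (innerSL ℝ)).comp (m.bilinearComp E E)
  exact ⟨(flipₗᵢ ℝ X H ℝ).toContinuousLinearEquiv.toContinuousLinearMap.comp s,
    fun _ _ _ => rfl⟩

theorem ContinuousLinearMap.exists_trilinear_sum_comp {ι : Type*} [Fintype ι]
    (t : A →L[ℝ] B →L[ℝ] C →L[ℝ] ℝ) (f : ι → X →L[ℝ] A) (g : ι → Y →L[ℝ] B) (h : ι → Z →L[ℝ] C) :
    ∃ T : X →L[ℝ] Y →L[ℝ] Z →L[ℝ] ℝ, ∀ x y z, T x y z = ∑ i, t (f i x) (g i y) (h i z) := by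
  refine ⟨∑ i, (compL ℝ Y (C →L[ℝ] ℝ) (Z →L[ℝ] ℝ) ((compL ℝ Z C ℝ).flip (h i))).comp
    (t.bilinearComp (f i) (g i)), fun x y z => ?_⟩
  simp only [sum_apply]
  rfl

theorem ContinuousLinearMap.exists_bilinear_sum_comp {ι : Type*} [Fintype ι]
    (t : A →L[ℝ] B →L[ℝ] ℝ) (f : ι → X →L[ℝ] A) (g : ι → Y →L[ℝ] B) :
    ∃ T : X →L[ℝ] Y →L[ℝ] ℝ, ∀ x y, T x y = ∑ i, t (f i x) (g i y) := by
  refine ⟨∑ i, t.bilinearComp (f i) (g i), fun x y => ?_⟩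
  simp only [sum_apply]
  rfl

end Multilinear

/-- The trilinear form `(u, g, w) ↦ ∫ u g w` is bounded on `H₀¹ × L² × H₀¹`, by Hölder's inequality
with exponents `4, 2, 4`. -/
theorem exists_trilinear_integral (hΩb : Bornology.IsBounded Ω) :
    ∃ t : H01 Ω →L[ℝ] L2 Ω →L[ℝ] H01 Ω →L[ℝ] ℝ, ∀ (u : H01 Ω) (g : L2 Ω) (w : H01 Ω),
      IntegrableOn (fun x => toL2 (u : H1 Ω) x * g x * toL2 (w : H1 Ω) x) Ω ∧
      t u g w = ∫ x in Ω, toL2 (u : H1 Ω) x * g x * toL2 (w : H1 Ω) x := by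
  obtain ⟨E, hE⟩ := exists_embedding_L4 hΩb
  let m : Lp ℝ 4 (volume.restrict Ω) →L[ℝ] Lp ℝ 4 (volume.restrict Ω) →L[ℝ] L2 Ω :=
    (ContinuousLinearMap.mul ℝ ℝ).holderL (volume.restrict Ω) 4 4 2
  obtain ⟨t, ht⟩ := ContinuousLinearMap.exists_trilinear_inner m E
  refine ⟨t, fun u g w => ?_⟩
  have hae : (fun x => (inner ℝ (m (E u) (E w) x) (g x) : ℝ)) =ᵐ[volume.restrict Ω]
      fun x => toL2 (u : H1 Ω) x * g x * toL2 (w : H1 Ω) x := by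
    have h1 : m (E u) (E w) =ᵐ[volume.restrict Ω] fun x => E u x * E w x :=
      ContinuousLinearMap.coeFn_holder (r := 2) (ContinuousLinearMap.mul ℝ ℝ) (E u) (E w)
    filter_upwards [h1, hE u, hE w] with x hx hu hw
    simp only [hx, hu, hw, RCLike.inner_apply, conj_trivial]
    ring
  refine ⟨(L2.integrable_inner (m (E u) (E w)) g).congr hae, ?_⟩
  rw [← integral_congr_ae hae, ht]
  exact L2.inner_def (m (E u) (E w)) g

/-- The heat convection form `b2` is a bounded trilinear form on `V × H¹ × H₀¹`. -/
theorem exists_trilinear_b2 (hΩb : Bornology.IsBounded Ω) :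
    ∃ B : V Ω →L[ℝ] H1 Ω →L[ℝ] H01 Ω →L[ℝ] ℝ,
      ∀ (v : V Ω) (T : H1 Ω) (φ : H01 Ω),
        IntegrableOn (fun x => (∑ i, toL2 ((v : H1Vec Ω) i) x * grad T i x) *
          toL2 (φ : H1 Ω) x) Ω ∧ B v T φ = b2 (v : H1Vec Ω) T φ := by
  obtain ⟨t, ht⟩ := exists_trilinear_integral hΩb
  obtain ⟨B, hB⟩ := t.exists_trilinear_sum_comp (V.componentCLM Ω) (partialCLM Ω)
    fun _ => ContinuousLinearMap.id ℝ (H01 Ω)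
  refine ⟨B, fun v T φ => ?_⟩
  have hint := fun i => (ht (V.componentCLM Ω i v) (grad T i) φ).1
  simp only [V.coe_componentCLM_apply] at hint
  simp only [b2, Finset.sum_mul]
  refine ⟨integrable_finsetSum _ fun i _ => hint i, ?_⟩
  rw [integral_finsetSum _ fun i _ => hint i, hB]
  exact Finset.sum_congr rfl fun i _ => (ht _ _ _).2

/-- The momentum convection form `b1` acts componentwise as `b2`. -/
theorem b1_eq_sum_b2 (hΩb : Bornology.IsBounded Ω) (v w φ : V Ω) :
    b1 (v : H1Vec Ω) w φ =
      ∑ j, b2 (v : H1Vec Ω) ((w : H1Vec Ω) j) ((φ : H1Vec Ω) j) := by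
  obtain ⟨B, hB⟩ := exists_trilinear_b2 hΩb
  rw [b1, integral_finsetSum]
  · rfl
  · exact fun j _ => (hB v ((w : H1Vec Ω) j) (V.componentCLM Ω j φ)).1

/-- The momentum convection form `b1` is a bounded trilinear form on `V × V × V`. -/
theorem exists_trilinear_b1 (hΩb : Bornology.IsBounded Ω) :
    ∃ B : V Ω →L[ℝ] V Ω →L[ℝ] V Ω →L[ℝ] ℝ,
      ∀ v w φ : V Ω, B v w φ = b1 (v : H1Vec Ω) w φ := by
  obtain ⟨B, hB⟩ := exists_trilinear_b2 hΩb
  obtain ⟨B', hB'⟩ := B.exists_trilinear_sum_comp (fun _ => ContinuousLinearMap.id ℝ (V Ω))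
    (fun j => (H01 Ω).subtypeL.comp (V.componentCLM Ω j)) (V.componentCLM Ω)
  refine ⟨B', fun v w φ => ?_⟩
  rw [b1_eq_sum_b2 hΩb, hB']
  exact Finset.sum_congr rfl fun j _ => (hB _ _ _).2

/-! ### Cancellation in the convection forms -/

theorem IsTestFunction.mul {φ ψ : Plane → ℝ} (hφ : IsTestFunction Ω φ)
    (hψ : IsTestFunction Ω ψ) : IsTestFunction Ω (fun x => φ x * ψ x) where
  contDiff := hφ.contDiff.mul hψ.contDiff
  hasCompactSupport := hφ.hasCompactSupport.mul_right
  tsupport_subset := (tsupport_mul_subset_left (f := φ) (g := ψ)).trans hφ.tsupport_subset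

/-- For a divergence-free `v` and a test function `φ`, `∫ (v · ∇φ) φ = ∫ v · ∇(φ²/2) = 0`: the weak
derivatives of `v` are tested with `φ²`. -/
theorem b2_self_of_mem_testSubspace (v : V Ω) {S : H1 Ω} (hS : S ∈ testSubspace Ω) :
    b2 (v : H1Vec Ω) S S = 0 := by
  obtain ⟨φ, hφ, hS, hS'⟩ := hS
  have hψ := hφ.mul hφ
  have hpd : ∀ i x, pderiv i (fun x => φ x * φ x) x = 2 * (pderiv i φ x * φ x) := fun i x => by
    simp only [pderiv]
    rw [fderiv_fun_mul hφ.differentiable.differentiableAt hφ.differentiable.differentiableAt]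
    simp
    ring
  -- The product rule turns `2 v · ∇φ φ` into `v · ∇(φ²)`.
  have h1 : 2 * b2 (v : H1Vec Ω) S S =
      ∑ i, ∫ x in Ω, toL2 ((v : H1Vec Ω) i) x * pderiv i (fun x => φ x * φ x) x := by
    rw [← integral_finsetSum _ fun i _ => integrable_L2_mul _ (hψ.memLp_pderiv i), b2,
      ← integral_const_mul]
    refine integral_congr_ae ?_
    filter_upwards [hS, hS' 0, hS' 1] with x hx h0 h1
    simp only [Fin.sum_univ_two, hpd, hx, h0, h1]
    ring
  have h2 : ∑ i, ∫ x in Ω, toL2 ((v : H1Vec Ω) i) x * pderiv i (fun x => φ x * φ x) x = 0 := by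
    have h3 : ∀ i, ∫ x in Ω, toL2 ((v : H1Vec Ω) i) x * pderiv i (fun x => φ x * φ x) x =
        -∫ x in Ω, grad ((v : H1Vec Ω) i) i x * (φ x * φ x) := fun i =>
      ((v : H1Vec Ω) i).2 i _ hψ
    simp only [h3, Finset.sum_neg_distrib]
    rw [Fin.sum_univ_two, ← integral_add_L2_mul _ _ hψ.memLp, ← Fin.sum_univ_two
      (fun i => grad ((v : H1Vec Ω) i) i), v.2.2, integral_zero_L2_mul, neg_zero]
  linarith

theorem b2_self (hΩb : Bornology.IsBounded Ω) (v : V Ω) {S : H1 Ω}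
    (hS : S ∈ H01 Ω) : b2 (v : H1Vec Ω) S S = 0 := by
  obtain ⟨B, hB⟩ := exists_trilinear_b2 hΩb
  obtain ⟨s, hs, hlim⟩ := mem_closure_iff_seq_limit.1 hS
  let s' : ℕ → H01 Ω := fun n => ⟨s n, (testSubspace Ω).le_topologicalClosure (hs n)⟩
  have hs' : Tendsto s' atTop (𝓝 ⟨S, hS⟩) := tendsto_subtype_rng.2 hlim
  have hc : Continuous fun w : H01 Ω => B v (w : H1 Ω) w := by fun_prop
  have h0 : ∀ n, B v (s' n : H1 Ω) (s' n) = 0 := fun n =>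
    (hB _ _ _).2.trans (b2_self_of_mem_testSubspace v (hs n))
  have hl := (hc.tendsto ⟨S, hS⟩).comp hs'
  rw [← (hB v S ⟨S, hS⟩).2]
  exact tendsto_nhds_unique (hl.congr h0) tendsto_const_nhds

theorem b1_self (hΩb : Bornology.IsBounded Ω) (v w : V Ω) :
    b1 (v : H1Vec Ω) w w = 0 := by
  rw [b1_eq_sum_b2 hΩb]
  exact Finset.sum_eq_zero fun j _ => b2_self hΩb v (w.2.1 j)

/-! ### The bilinear forms -/

/-- The buoyancy term as a bounded bilinear form. -/
theorem exists_bilinear_buoyancy (Ω : Set Plane) :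
    ∃ c : H1 Ω →L[ℝ] V Ω →L[ℝ] ℝ, ∀ T (φ : V Ω), c T φ = buoyancy T (φ : H1Vec Ω) := by
  refine ⟨(innerSL ℝ).bilinearComp (toL2CLM Ω)
    ((toL2CLM Ω).comp ((H01 Ω).subtypeL.comp (V.componentCLM Ω 1))), fun T φ => ?_⟩
  refine (L2.inner_def (𝕜 := ℝ) (toL2 T) (toL2 ((φ : H1Vec Ω) 1))).trans ?_
  simp [buoyancy, buoyancyDir, mul_comm]

theorem exists_bilinear_gradInner (Ω : Set Plane) :
    ∃ d : H1 Ω →L[ℝ] H01 Ω →L[ℝ] ℝ, ∀ T (φ : H01 Ω), d T φ = gradInner T φ :=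
  ⟨(innerSL ℝ).bilinearComp (gradCLM Ω) ((gradCLM Ω).comp (H01 Ω).subtypeL), fun _ _ => rfl⟩

theorem exists_bilinear_gradInnerVec (Ω : Set Plane) :
    ∃ a : V Ω →L[ℝ] V Ω →L[ℝ] ℝ, ∀ v φ : V Ω, a v φ = gradInnerVec (v : H1Vec Ω) φ := by
  obtain ⟨d, hd⟩ := exists_bilinear_gradInner Ω
  obtain ⟨a, ha⟩ := d.exists_bilinear_sum_comp
    (fun j => (H01 Ω).subtypeL.comp (V.componentCLM Ω j)) (V.componentCLM Ω)
  refine ⟨a, fun v φ => ?_⟩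
  rw [ha]
  exact Finset.sum_congr rfl fun j _ => hd _ _

/-! ### Well-posedness of an abstract system with small data -/

section SmallData

/-- The contraction mapping principle on the closed unit ball, in a form that also gives uniqueness
in the whole space once all fixed points are known to lie in the ball. -/
theorem existsUnique_fixedPoint_of_contracting_closedBall {E : Type*} [NormedAddCommGroup E]
    [CompleteSpace E] (Φ : E → E) (hmaps : ∀ x, ‖x‖ ≤ 1 → ‖Φ x‖ ≤ 1)
    (hlip : ∀ x y, ‖x‖ ≤ 1 → ‖y‖ ≤ 1 → ‖Φ x - Φ y‖ ≤ 1 / 2 * ‖x - y‖)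
    (hfix : ∀ x, Φ x = x → ‖x‖ ≤ 1) : ∃! x, Φ x = x := by
  have hm : MapsTo Φ (Metric.closedBall 0 1) (Metric.closedBall 0 1) := fun x hx => by
    simpa using hmaps x (by simpa using hx)
  have hc : ContractingWith (1 / 2) (hm.restrict Φ _ _) := by
    refine ⟨by rw [← NNReal.coe_lt_coe]; norm_num, LipschitzWith.of_dist_le_mul fun x y => ?_⟩
    have := hlip x y (mem_closedBall_zero_iff.1 x.2) (mem_closedBall_zero_iff.1 y.2)
    simpa [Subtype.dist_eq, dist_eq_norm] using this
  obtain ⟨x, hx, hxf, -⟩ := hc.exists_fixedPoint' Metric.isClosed_closedBall.isComplete hm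
    (x := 0) (by simp) (edist_ne_top _ _)
  refine ⟨x, hxf, fun y hy => ?_⟩
  have hxy := hlip y x (hfix y hy) (hfix x hxf)
  rw [hy, hxf] at hxy
  have : ‖y - x‖ = 0 := le_antisymm (by linarith [norm_nonneg (y - x)]) (norm_nonneg _)
  exact sub_eq_zero.1 (norm_eq_zero.1 this)

theorem mul_norm_le_of_coercive {V : Type*} [NormedAddCommGroup V] [NormedSpace ℝ V]
    {a : V →L[ℝ] V →L[ℝ] ℝ} {α K : ℝ} (ha : ∀ v, α * ‖v‖ ^ 2 ≤ a v v) (hK : 0 ≤ K) {v : V}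
    (h : a v v ≤ K * ‖v‖) : α * ‖v‖ ≤ K := by
  rcases (norm_nonneg v).eq_or_lt' with h0 | h0
  · rwa [h0, mul_zero]
  · refine le_of_mul_le_mul_right ?_ h0
    nlinarith [ha v]

/-- A solution operator for a coercive form, by the Lax-Milgram theorem. -/
theorem exists_solution_of_coercive {V : Type*} [NormedAddCommGroup V] [InnerProductSpace ℝ V]
    [CompleteSpace V] {a : V →L[ℝ] V →L[ℝ] ℝ} {α : ℝ} (hα : 0 < α)
    (ha : ∀ v, α * ‖v‖ ^ 2 ≤ a v v) :
    ∃ R : (V →L[ℝ] ℝ) → V, (∀ ℓ φ, a (R ℓ) φ = ℓ φ) ∧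
      (∀ ℓ v, (∀ φ, a v φ = ℓ φ) → R ℓ = v) ∧ (∀ ℓ, α * ‖R ℓ‖ ≤ ‖ℓ‖) ∧
      ∀ ℓ ℓ', α * ‖R ℓ - R ℓ'‖ ≤ ‖ℓ - ℓ'‖ := by
  have hco : IsCoercive a := ⟨α, hα, fun u => by have := ha u; rwa [pow_two, ← mul_assoc] at this⟩
  have hex : ∀ ℓ : V →L[ℝ] ℝ, ∃ u, ∀ φ, a u φ = ℓ φ := fun ℓ => by
    refine ⟨hco.continuousLinearEquivOfBilin.symm ((InnerProductSpace.toDual ℝ V).symm ℓ),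
      fun φ => ?_⟩
    rw [← hco.continuousLinearEquivOfBilin_apply, ContinuousLinearEquiv.apply_symm_apply,
      InnerProductSpace.toDual_symm_apply]
  choose R hR using hex
  have hbound : ∀ (u : V) (ℓ : V →L[ℝ] ℝ), (∀ φ, a u φ = ℓ φ) → α * ‖u‖ ≤ ‖ℓ‖ := fun u ℓ h =>
    mul_norm_le_of_coercive ha (norm_nonneg _) (by
      rw [h]
      exact (le_abs_self _).trans (ℓ.le_opNorm u))
  have hlip : ∀ (u w : V) (ℓ ℓ' : V →L[ℝ] ℝ), (∀ φ, a u φ = ℓ φ) → (∀ φ, a w φ = ℓ' φ) →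
      α * ‖u - w‖ ≤ ‖ℓ - ℓ'‖ := fun u w ℓ ℓ' h h' => hbound _ _ fun φ => by simp [h, h']
  refine ⟨R, hR, fun ℓ v h => ?_, fun ℓ => hbound _ _ (hR ℓ), fun ℓ ℓ' =>
    hlip _ _ _ _ (hR ℓ) (hR ℓ')⟩
  have h0 := hlip _ _ _ _ (hR ℓ) h
  rw [sub_self, norm_zero] at h0
  have : ‖R ℓ - v‖ = 0 := le_antisymm (by nlinarith) (norm_nonneg _)
  exact sub_eq_zero.1 (norm_eq_zero.1 this)

variable {V W H : Type*} [NormedAddCommGroup V] [InnerProductSpace ℝ V] [CompleteSpace V]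
  [NormedAddCommGroup W] [InnerProductSpace ℝ W] [CompleteSpace W]
  [NormedAddCommGroup H] [NormedSpace ℝ H]

/-- Well-posedness of an abstract Boussinesq system with small data. The unknown `T = h + j S` is
split into the boundary datum `h` and `S`, and the equations are normalised so that the coercive
parts have coefficient `1`.

The solution operators of the coercive parts turn the system into a fixed point equation, which is
a contraction on the unit ball. The cancellations `b₁ v v v = 0` and `b₂ v (j S) S = 0` give an
a priori bound that puts every solution into this ball. -/
theorem exists_forall_existsUnique_boussinesq (a : V →L[ℝ] V →L[ℝ] ℝ)
    (b₁ : V →L[ℝ] V →L[ℝ] V →L[ℝ] ℝ) (b₂ : V →L[ℝ] H →L[ℝ] W →L[ℝ] ℝ) (c : H →L[ℝ] V →L[ℝ] ℝ)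
    (d : H →L[ℝ] W →L[ℝ] ℝ) (j : W →L[ℝ] H) {α : ℝ} (hα : 0 < α) (hα1 : α ≤ 1)
    (ha : ∀ v, α * ‖v‖ ^ 2 ≤ a v v) (hd : ∀ S, α * ‖S‖ ^ 2 ≤ d (j S) S)
    (hb₁ : ∀ v, b₁ v v v = 0) (hb₂ : ∀ v S, b₂ v (j S) S = 0) :
    ∃ ε > 0, ∀ r σ κ : ℝ, r ∈ Ioo 0 ε → σ ∈ Ioo 0 ε → κ ∈ Ioo 0 ε →
      ∀ (g₁ : V →L[ℝ] ℝ) (g₂ : W →L[ℝ] ℝ) (h : H), ‖g₁‖ ≤ ε → ‖g₂‖ ≤ ε → ‖h‖ ≤ ε →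
      ∃! p : V × W,
        (∀ φ, r * b₁ p.1 p.1 φ + a p.1 φ - κ * c (h + j p.2) φ = r * g₁ φ) ∧
        ∀ φ, σ * b₂ p.1 (h + j p.2) φ + d (h + j p.2) φ = σ * g₂ φ := by
  obtain ⟨M, hM, hMb₁, hMb₂, hMc, hMd, hMj⟩ : ∃ M : ℝ, 1 ≤ M ∧ ‖b₁‖ ≤ M ∧ ‖b₂‖ ≤ M ∧ ‖c‖ ≤ M ∧
      ‖d‖ ≤ M ∧ ‖j‖ ≤ M := by
    have h1 := norm_nonneg b₁
    have h2 := norm_nonneg b₂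
    have h3 := norm_nonneg c
    have h4 := norm_nonneg d
    have h5 := norm_nonneg j
    exact ⟨1 + ‖b₁‖ + ‖b₂‖ + ‖c‖ + ‖d‖ + ‖j‖, by linarith, by linarith, by linarith, by linarith,
      by linarith, by linarith⟩
  have hM0 : 0 ≤ M := zero_le_one.trans hM
  obtain ⟨R₁, hR₁, hR₁', hR₁n, hR₁l⟩ := exists_solution_of_coercive hα ha
  obtain ⟨R₂, hR₂, hR₂', hR₂n, hR₂l⟩ := exists_solution_of_coercive (a := d.comp j) hα hd
  have nj : ∀ S, ‖j S‖ ≤ M * ‖S‖ := fun S => (j.le_opNorm S).trans (by gcongr)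
  have nc : ∀ T, ‖c T‖ ≤ M * ‖T‖ := fun T => (c.le_opNorm T).trans (by gcongr)
  have nd : ∀ T, ‖d T‖ ≤ M * ‖T‖ := fun T => (d.le_opNorm T).trans (by gcongr)
  have nb₁ : ∀ v w, ‖b₁ v w‖ ≤ M * ‖v‖ * ‖w‖ := fun v w => (b₁.le_opNorm₂ v w).trans (by gcongr)
  have nb₂ : ∀ v T, ‖b₂ v T‖ ≤ M * ‖v‖ * ‖T‖ := fun v w => (b₂.le_opNorm₂ v w).trans (by gcongr)
  -- With `8 ε M² = α`, a term bounded by `k ε M²` contributes `k / 8` after dividing by `α`.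
  obtain ⟨ε, hε, hεα⟩ : ∃ ε > 0, 8 * (ε * M ^ 2) = α :=
    ⟨α / (8 * M ^ 2), by positivity, by field_simp⟩
  have hM2 : M ≤ M ^ 2 := by nlinarith
  have hεM : ε * M ≤ ε * M ^ 2 := by gcongr
  have hεM1 : ε ≤ ε * M := le_mul_of_one_le_right hε.le hM
  have hε1 : ε ≤ 1 := by linarith
  refine ⟨ε, hε, fun r σ κ hr hσ hκ g₁ g₂ h hg₁ hg₂ hh => ?_⟩
  have hr0 := hr.1.le
  have hr1 := hr.2.le
  have hσ0 := hσ.1.le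
  have hσ1 := hσ.2.le
  have hκ0 := hκ.1.le
  have hκ1 := hκ.2.le
  have hg₁1 := hg₁.trans hε1
  have hg₂1 := hg₂.trans hε1
  have hh1 := hh.trans hε1
  have nT : ∀ S, ‖h + j S‖ ≤ 1 + M * ‖S‖ := fun S =>
    (norm_add_le _ _).trans (add_le_add hh1 (nj S))
  -- The right-hand sides of the two equations as functionals of the unknown `p = (v, S)`.
  let F : V × W → V →L[ℝ] ℝ := fun p => r • g₁ - r • b₁ p.1 p.1 + κ • c (h + j p.2)
  let G : V × W → W →L[ℝ] ℝ := fun p => σ • g₂ - σ • b₂ p.1 (h + j p.2) - d h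
  have hF : ∀ p : V × W, ‖p‖ ≤ 1 → ‖F p‖ ≤ 4 * (ε * M ^ 2) := fun p hp => by
    have hv : ‖p.1‖ ≤ 1 := (norm_fst_le p).trans hp
    have hS : ‖p.2‖ ≤ 1 := (norm_snd_le p).trans hp
    calc ‖F p‖ ≤ ‖r • g₁‖ + ‖r • b₁ p.1 p.1‖ + ‖κ • c (h + j p.2)‖ :=
          (norm_add_le _ _).trans (by gcongr; exact norm_sub_le _ _)
      _ ≤ ε * 1 + ε * (M * 1 * 1) + ε * (M * (1 + M * 1)) := by
          rw [norm_smul, norm_smul, norm_smul, Real.norm_of_nonneg hr0, Real.norm_of_nonneg hκ0]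
          gcongr
          · exact (nb₁ _ _).trans (by gcongr)
          · exact (nc _).trans (by gcongr; exact (nT _).trans (by gcongr))
      _ ≤ 4 * (ε * M ^ 2) := by linarith
  have hG : ∀ p : V × W, ‖p‖ ≤ 1 → ‖G p‖ ≤ 4 * (ε * M ^ 2) := fun p hp => by
    have hv : ‖p.1‖ ≤ 1 := (norm_fst_le p).trans hp
    have hS : ‖p.2‖ ≤ 1 := (norm_snd_le p).trans hp
    calc ‖G p‖ ≤ ‖σ • g₂‖ + ‖σ • b₂ p.1 (h + j p.2)‖ + ‖d h‖ :=
          (norm_sub_le _ _).trans (by gcongr; exact norm_sub_le _ _)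
      _ ≤ ε * 1 + ε * (M * 1 * (1 + M * 1)) + M * ε := by
          rw [norm_smul, norm_smul, Real.norm_of_nonneg hσ0]
          gcongr
          · exact (nb₂ _ _).trans (by gcongr; exact (nT _).trans (by gcongr))
          · exact (nd _).trans (by gcongr)
      _ ≤ 4 * (ε * M ^ 2) := by linarith
  have hFl : ∀ p q : V × W, ‖p‖ ≤ 1 → ‖q‖ ≤ 1 → ‖F p - F q‖ ≤ 4 * (ε * M ^ 2) * ‖p - q‖ :=
      fun p q hp hq => by
    have hv : ‖p.1‖ ≤ 1 := (norm_fst_le p).trans hp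
    have hw : ‖q.1‖ ≤ 1 := (norm_fst_le q).trans hq
    have h1 : ‖p.1 - q.1‖ ≤ ‖p - q‖ := norm_fst_le (p - q)
    have h2 : ‖p.2 - q.2‖ ≤ ‖p - q‖ := norm_snd_le (p - q)
    have e : F p - F q = κ • c (j (p.2 - q.2)) -
        r • (b₁ p.1 (p.1 - q.1) + b₁ (p.1 - q.1) q.1) := by
      ext φ
      simp [F]
      ring
    rw [e]
    calc _ ≤ ‖κ • c (j (p.2 - q.2))‖ + ‖r • (b₁ p.1 (p.1 - q.1) + b₁ (p.1 - q.1) q.1)‖ :=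
          norm_sub_le _ _
      _ ≤ ε * (M * (M * ‖p - q‖)) + ε * (M * 1 * ‖p - q‖ + M * ‖p - q‖ * 1) := by
          rw [norm_smul, norm_smul, Real.norm_of_nonneg hr0, Real.norm_of_nonneg hκ0]
          gcongr
          · exact (nc _).trans (by gcongr; exact (nj _).trans (by gcongr))
          · exact (norm_add_le _ _).trans (add_le_add ((nb₁ _ _).trans (by gcongr))
              ((nb₁ _ _).trans (by gcongr)))
      _ ≤ _ := by nlinarith [norm_nonneg (p - q)]
  have hGl : ∀ p q : V × W, ‖p‖ ≤ 1 → ‖q‖ ≤ 1 → ‖G p - G q‖ ≤ 4 * (ε * M ^ 2) * ‖p - q‖ :=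
      fun p q hp hq => by
    have hS : ‖p.2‖ ≤ 1 := (norm_snd_le p).trans hp
    have hw : ‖q.1‖ ≤ 1 := (norm_fst_le q).trans hq
    have h1 : ‖p.1 - q.1‖ ≤ ‖p - q‖ := norm_fst_le (p - q)
    have h2 : ‖p.2 - q.2‖ ≤ ‖p - q‖ := norm_snd_le (p - q)
    have e : G p - G q = -(σ • (b₂ (p.1 - q.1) (h + j p.2) + b₂ q.1 (j (p.2 - q.2)))) := by
      ext φ
      simp [G]
      ring
    rw [e, norm_neg]
    calc _ ≤ ε * (M * ‖p - q‖ * (1 + M * 1) + M * 1 * (M * ‖p - q‖)) := by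
          rw [norm_smul, Real.norm_of_nonneg hσ0]
          gcongr
          exact (norm_add_le _ _).trans (add_le_add
            ((nb₂ _ _).trans (by gcongr; exact (nT _).trans (by gcongr)))
            ((nb₂ _ _).trans (by gcongr; exact (nj _).trans (by gcongr))))
      _ ≤ _ := by nlinarith [norm_nonneg (p - q)]
  have hcancel : ∀ {x y : ℝ}, α * x ≤ 4 * (ε * M ^ 2) * y → x ≤ 1 / 2 * y := fun {x y} hxy => by
    refine le_of_mul_le_mul_left ?_ hα
    linear_combination hxy + (1 / 2 * y) * hεα
  have hsol : ∀ p : V × W, (R₁ (F p), R₂ (G p)) = p ↔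
      (∀ φ, r * b₁ p.1 p.1 φ + a p.1 φ - κ * c (h + j p.2) φ = r * g₁ φ) ∧
        ∀ φ, σ * b₂ p.1 (h + j p.2) φ + d (h + j p.2) φ = σ * g₂ φ := fun p => by
    rw [Prod.ext_iff]
    refine and_congr ⟨fun hp φ => ?_, fun hp => hR₁' _ _ fun φ => ?_⟩
      ⟨fun hp φ => ?_, fun hp => hR₂' _ _ fun φ => ?_⟩
    · have := hR₁ (F p) φ
      rw [show R₁ (F p) = p.1 from hp] at this
      simp [F] at this ⊢
      linarith
    · have := hp φ
      simp [F] at this ⊢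
      linarith
    · have := hR₂ (G p) φ
      rw [show R₂ (G p) = p.2 from hp] at this
      simp [G] at this ⊢
      linarith
    · have := hp φ
      simp [G] at this ⊢
      linarith
  simp only [← hsol]
  refine existsUnique_fixedPoint_of_contracting_closedBall _ (fun p hp => ?_)
    (fun p q hp hq => ?_) fun p hp => ?_
  · rw [Prod.norm_def]
    refine max_le ?_ ?_
    · linarith [hcancel (y := 1) (((hR₁n _).trans (hF p hp)).trans (by linarith))]
    · linarith [hcancel (y := 1) (((hR₂n _).trans (hG p hp)).trans (by linarith))]
  · rw [Prod.norm_def]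
    exact max_le (hcancel ((hR₁l _ _).trans (hFl p q hp hq)))
      (hcancel ((hR₂l _ _).trans (hGl p q hp hq)))
  · -- The a priori bound: test the equations with the solution itself.
    obtain ⟨h₁, h₂⟩ := (hsol p).1 hp
    obtain ⟨v, S⟩ := p
    have nv := norm_nonneg v
    have nS := norm_nonneg S
    have kv : α * ‖v‖ ≤ ε * 1 + ε * (M * (1 + M * ‖S‖)) := by
      refine mul_norm_le_of_coercive ha (by positivity) ?_
      have e : a v v = (r • g₁ + κ • c (h + j S)) v := by
        have := h₁ v
        simp [hb₁] at this ⊢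
        linarith
      rw [e]
      refine (Real.le_norm_self _).trans ((ContinuousLinearMap.le_opNorm _ _).trans ?_)
      gcongr
      refine (norm_add_le _ _).trans ?_
      rw [norm_smul, norm_smul, Real.norm_of_nonneg hr0, Real.norm_of_nonneg hκ0]
      gcongr
      exact (nc _).trans (by gcongr; exact nT _)
    have kS : α * ‖S‖ ≤ ε * 1 + ε * (M * ‖v‖ * 1) + M * ε := by
      refine mul_norm_le_of_coercive (a := d.comp j) hd (by positivity) ?_
      have e : d (j S) S = (σ • g₂ - σ • b₂ v h - d h) S := by
        have := h₂ S
        simp [hb₂] at this ⊢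
        linarith
      rw [ContinuousLinearMap.comp_apply, e]
      refine (Real.le_norm_self _).trans ((ContinuousLinearMap.le_opNorm _ _).trans ?_)
      gcongr
      refine (norm_sub_le _ _).trans (add_le_add ((norm_sub_le _ _).trans ?_)
        ((nd h).trans (by gcongr)))
      rw [norm_smul, norm_smul, Real.norm_of_nonneg hσ0]
      gcongr
      exact (nb₂ _ _).trans (by gcongr)
    have hp0 : 0 < ε * M ^ 2 := by linarith
    have kv' : 8 * ‖v‖ ≤ 2 + ‖S‖ := by
      refine le_of_mul_le_mul_left ?_ hp0
      linear_combination kv + hεM + hεM1 + hεM + ‖v‖ * hεα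
    have kS' : 8 * ‖S‖ ≤ 2 + ‖v‖ := by
      refine le_of_mul_le_mul_left ?_ hp0
      have := mul_le_mul_of_nonneg_right hεM nv
      linear_combination kS + hεM + hεM1 + hεM + this + ‖S‖ * hεα
    rw [Prod.norm_def]
    exact max_le (by change ‖v‖ ≤ 1; linarith) (by change ‖S‖ ≤ 1; linarith)

end SmallData

/-! ### The weak formulation as an operator equation -/

theorem momentum_eq_iff_normalised {r γ x y z g : ℝ} (hr : r ≠ 0) :
    x + 1 / r * y - γ / r ^ 2 * z = g ↔ r * x + y - γ / r * z = r * g := by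
  rw [← mul_right_inj' hr]
  have : r * (x + 1 / r * y - γ / r ^ 2 * z) = r * x + y - γ / r * z := by field_simp
  rw [this]

theorem heat_eq_iff_normalised {σ x y g : ℝ} (hσ : σ ≠ 0) :
    x + 1 / σ * y = g ↔ σ * x + y = σ * g := by
  rw [← mul_right_inj' hσ]
  have : σ * (x + 1 / σ * y) = σ * x + y := by field_simp
  rw [this]

/-- The weak formulation in the unknowns `v` and `S = T - Td`, multiplied by `Re` and `Re Pr`. -/
theorem isWeakSolution_add_iff {Re Pr Gr : ℝ} (hRe : Re ≠ 0) (hPr : Pr ≠ 0) {g₁ : V Ω →ₗ[ℝ] ℝ}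
    {g₂ : H01 Ω →ₗ[ℝ] ℝ} {Td : H1 Ω} {v : V Ω} {S : H01 Ω} :
    IsWeakSolution Re Pr Gr g₁ g₂ Td v (Td + (S : H1 Ω)) ↔
      (∀ φ : V Ω, Re * b1 (v : H1Vec Ω) v φ + gradInnerVec (v : H1Vec Ω) φ
        - Gr / Re * buoyancy (Td + (S : H1 Ω)) (φ : H1Vec Ω) = Re * g₁ φ) ∧
      ∀ φ : H01 Ω, Re * Pr * b2 (v : H1Vec Ω) (Td + (S : H1 Ω)) φ +
        gradInner (Td + (S : H1 Ω)) (φ : H1 Ω) = Re * Pr * g₂ φ := by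
  refine ⟨fun h => ⟨fun φ => (momentum_eq_iff_normalised hRe).1 (h.momentum φ),
    fun φ => (heat_eq_iff_normalised (mul_ne_zero hRe hPr)).1 (h.heat φ)⟩, fun h => ⟨?_,
    fun φ => (momentum_eq_iff_normalised hRe).2 (h.1 φ),
    fun φ => (heat_eq_iff_normalised (mul_ne_zero hRe hPr)).2 (h.2 φ)⟩⟩
  rw [add_sub_cancel_left]
  exact S.2

theorem exists_continuousLinearMap_of_vDualNormLE {g : V Ω →ₗ[ℝ] ℝ} {δ : ℝ} (hδ : 0 ≤ δ)
    (hg : VDualNormLE g δ) : ∃ G : V Ω →L[ℝ] ℝ, ‖G‖ ≤ δ ∧ ∀ φ, G φ = g φ := by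
  have h : ∀ φ : V Ω, ‖g φ‖ ≤ δ * ‖φ‖ := fun φ =>
    (hg φ).trans (mul_le_mul_of_nonneg_left (gradNormVec_le _) hδ)
  exact ⟨g.mkContinuous δ h, g.mkContinuous_norm_le hδ h, fun _ => rfl⟩

theorem exists_continuousLinearMap_of_hNegOneNormLE {g : H01 Ω →ₗ[ℝ] ℝ} {δ : ℝ} (hδ : 0 ≤ δ)
    (hg : HNegOneNormLE g δ) : ∃ G : H01 Ω →L[ℝ] ℝ, ‖G‖ ≤ δ ∧ ∀ φ, G φ = g φ := by
  have h : ∀ φ : H01 Ω, ‖g φ‖ ≤ δ * ‖φ‖ := fun φ =>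
    (hg φ).trans (mul_le_mul_of_nonneg_left (gradNorm_le _) hδ)
  exact ⟨g.mkContinuous δ h, g.mkContinuous_norm_le hδ h, fun _ => rfl⟩

end

set_option maxSynthPendingDepth 3 in
set_option maxHeartbeats 8000000 in
theorem theorem2p1 (Ω : Set Plane) (hΩ : IsOpen Ω) (hΩb : Bornology.IsBounded Ω) :
    ∃ ε₁ > (0 : ℝ), ∃ ε₂ > (0 : ℝ), ∃ ε₃ > (0 : ℝ), ∃ δ > (0 : ℝ),
      ∀ Re Pr Gr : ℝ, Re ∈ Ioo 0 ε₁ → Pr ∈ Ioo 0 (ε₂ / Re) → Gr ∈ Ioo 0 (ε₃ * Re) →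
      ∀ (g₁ : V Ω →ₗ[ℝ] ℝ) (g₂ : H01 Ω →ₗ[ℝ] ℝ) (Td : H1 Ω),
        VDualNormLE g₁ δ → HNegOneNormLE g₂ δ → ‖Td‖ ≤ δ →
        ∃! p : V Ω × H1 Ω, IsWeakSolution Re Pr Gr g₁ g₂ Td p.1 p.2 := by
  obtain ⟨α, hα, hα1, hco⟩ := exists_coercive_gradInner hΩb
  obtain ⟨a, ha⟩ := exists_bilinear_gradInnerVec Ω
  obtain ⟨B₁, hB₁⟩ := exists_trilinear_b1 hΩb
  obtain ⟨B₂, hB₂⟩ := exists_trilinear_b2 hΩb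
  obtain ⟨c, hc⟩ := exists_bilinear_buoyancy Ω
  obtain ⟨d, hd⟩ := exists_bilinear_gradInner Ω
  obtain ⟨ε, hε, h⟩ := exists_forall_existsUnique_boussinesq a B₁ B₂ c d (H01 Ω).subtypeL hα hα1
    (fun v => by rw [ha]; exact coercive_gradInnerVec hco v)
    (fun S => by rw [hd]; exact hco S S.2)
    (fun v => by rw [hB₁]; exact b1_self hΩb v v)
    (fun v S => ((hB₂ v S S).2).trans (b2_self hΩb v S.2))
  refine ⟨ε, hε, ε, hε, ε, hε, ε, hε, fun Re Pr Gr hRe hPr hGr g₁ g₂ Td hg₁ hg₂ hTd => ?_⟩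
  obtain ⟨G₁, hG₁, hG₁'⟩ := exists_continuousLinearMap_of_vDualNormLE hε.le hg₁
  obtain ⟨G₂, hG₂, hG₂'⟩ := exists_continuousLinearMap_of_hNegOneNormLE hε.le hg₂
  have hσ : Re * Pr ∈ Ioo 0 ε :=
    ⟨mul_pos hRe.1 hPr.1, by rw [mul_comm]; exact (lt_div_iff₀ hRe.1).1 hPr.2⟩
  have hκ : Gr / Re ∈ Ioo 0 ε := ⟨div_pos hGr.1 hRe.1, (div_lt_iff₀ hRe.1).2 hGr.2⟩
  have hiff : ∀ (v : V Ω) (S : H01 Ω), IsWeakSolution Re Pr Gr g₁ g₂ Td v (Td + (S : H1 Ω)) ↔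
      (∀ φ, Re * B₁ v v φ + a v φ - Gr / Re * c (Td + (S : H1 Ω)) φ = Re * G₁ φ) ∧
        ∀ φ, Re * Pr * B₂ v (Td + (S : H1 Ω)) φ + d (Td + (S : H1 Ω)) φ =
          Re * Pr * G₂ φ := fun v S => by
    rw [isWeakSolution_add_iff hRe.1.ne' hPr.1.ne']
    refine and_congr (forall_congr' fun φ => ?_) (forall_congr' fun φ => ?_)
    · rw [hB₁, ha, hc, hG₁']
    · rw [(hB₂ v _ φ).2, hd, hG₂']
  obtain ⟨⟨v, S⟩, hsol, huniq⟩ := h Re (Re * Pr) (Gr / Re) hRe hσ hκ G₁ G₂ Td hG₁ hG₂ hTd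
  refine ⟨(v, Td + S), (hiff v S).2 hsol, ?_⟩
  rintro ⟨w, T⟩ hwT
  obtain ⟨S', hS'⟩ : ∃ S' : H01 Ω, T = Td + S' :=
    ⟨⟨T - Td, hwT.boundary⟩, (add_sub_cancel Td T).symm⟩
  subst hS'
  have := huniq (w, S') ((hiff w S').1 hwT)
  simp only [Prod.mk.injEq] at this ⊢
  exact ⟨this.1, by rw [this.2]⟩
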